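/- Let $A=[a_{ij}]\in\mathbb{R}^{n\times n}$ be a symmetric matrix with nonnegative entries and zero diagonal, and let $\mathcal{G}$ be the undirected weighted graph on $\{1,\dots,n\}$ with an edge $\{i,j\}$ if and only if $a_{ij}>0$; assume that $\mathcal{G}$ is connected. For each edge $\{i,j\}$ let $g_{ij}=g_{ji}:\mathbb{R}\to\mathbb{R}$ be an odd, increasing (not necessarily strictly increasing, possibly discontinuous) function with $\lim_{y\to\infty}|g_{ij}(y)|=\infty$. Order the edges as $e_1,\dots,e_m$ and orient each of them arbitrarily; let $a_k$ and $g_k$ be the weight and the nonlinearity of $e_k$, and let $B\in\mathbb{R}^{n\times m}$ be the incidence matrix ($B_{ik}=1$ if $e_k$ originates from $i$, $B_{ik}=-1$ if $e_k$ ends at $i$, and $B_{ik}=0$ otherwise). Consider the system $$\dot x_i=-\sum_{j=1}^n a_{ij}\,g_{ij}(x_i-x_j),\qquad i=1,\dots,n .\qquad (*)$$ For a map $X:\mathbb{R}^p\to\mathbb{R}^q$ let $$\mathcal{F}[X](x)=\bigcap_{\delta>0}\ \bigcap_{\mu(S)=0}\overline{\mathrm{co}}\,X\big(B(x,\delta)\setminus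 S\big)$$ be its Filippov set-valued map ($\mu$ is the Lebesgue measure). A Filippov trajectory of $\dot x=X(x)$ is a function $x:[0,\infty)\to\mathbb{R}^n$ that is absolutely continuous on every $[0,t_1]$ and satisfies $\dot x(t)\in\mathcal{F}[X](x(t))$ for almost every $t\ge 0$. Then $(*)$ can be written as $\dot x=-B\,g(B^\top x)$ with $g(y)=(a_1g_1(y_1),\dots,a_mg_m(y_m))^\top$, and every Filippov trajectory $x$ of $(*)$ converges to the set $$\mathcal{H}_1=\Big\{x\in\mathbb{R}^n \;:\; 0_m\in\prod_{k=1}^m\mathcal{F}[g_k]\big(B_{\cdot,k}^\top x\big)\Big\},$$ that is, $\operatorname{dist}(x(t),\mathcal{H}_1)\to 0$ as $t\to\infty$. -/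

import Mathlib

open Set Filter Topology MeasureTheory
open scoped ENNReal Matrix

noncomputable section

namespace Consensus

/-- The Filippov set-valued map of `X`: the intersection, over all radii `δ > 0` and all Lebesgue
null sets `S`, of the closed convex hulls of `X (B(x, δ) \ S)`. -/
def filippovMap {E F : Type*} [PseudoMetricSpace E] [MeasureSpace E]
    [AddCommGroup F] [Module ℝ F] [TopologicalSpace F] (X : E → F) (x : E) : Set F :=
  ⋂ (δ : ℝ) (_ : 0 < δ) (S : Set E) (_ : volume S = 0),
    closure (convexHull ℝ (X '' (Metric.ball x δ \ S)))

/-- `x` is a Filippov solution of `ẋ = X x` on `[0, t₁]`: it is absolutely continuous there, and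
at almost every time it is differentiable with `ẋ(t) ∈ F[X](x(t))`. -/
def IsFilippovSolutionOn {n : ℕ} (X : EuclideanSpace ℝ (Fin n) → EuclideanSpace ℝ (Fin n))
    (x : ℝ → EuclideanSpace ℝ (Fin n)) (t₁ : ℝ) : Prop :=
  AbsolutelyContinuousOnInterval x 0 t₁ ∧
    ∀ᵐ t : ℝ, t ∈ Ioo 0 t₁ → DifferentiableAt ℝ x t ∧ deriv x t ∈ filippovMap X (x t)

/-- `x` is a Filippov solution (trajectory) of `ẋ = X x` on `[0, ∞)`. The values of `x` at negative
times are irrelevant. -/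
def IsFilippovTrajectory {n : ℕ} (X : EuclideanSpace ℝ (Fin n) → EuclideanSpace ℝ (Fin n))
    (x : ℝ → EuclideanSpace ℝ (Fin n)) : Prop :=
  ∀ t₁ : ℝ, 0 < t₁ → IsFilippovSolutionOn X x t₁

/-- A weighted undirected graph on the nodes `Fin n`, given by its symmetric weighted adjacency
matrix with nonnegative entries and zero diagonal. -/
structure WeightedGraph (n : ℕ) where
  /-- the weighted adjacency matrix -/
  weight : Matrix (Fin n) (Fin n) ℝ
  nonneg : ∀ i j, 0 ≤ weight i j
  symm : ∀ i j, weight i j = weight j i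
  loopless : ∀ i, weight i i = 0

/-- The underlying simple graph: `i` and `j` are joined by an edge iff their weight is positive. -/
def WeightedGraph.toSimpleGraph {n : ℕ} (G : WeightedGraph n) : SimpleGraph (Fin n) where
  Adj i j := 0 < G.weight i j
  symm := ⟨fun i j h => by rw [G.symm j i]; exact h⟩
  loopless := ⟨fun i h => by rw [G.loopless i] at h; exact lt_irrefl _ h⟩

/-- An ordering of the `m` edges of an undirected graph, with an orientation of each of them
(the `k`-th edge goes from `tail k` to `head k`): every edge is listed exactly once. -/
structure EdgeOrdering {n : ℕ} (G : WeightedGraph n) (m : ℕ) where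
  /-- the node from which the edge originates -/
  tail : Fin m → Fin n
  /-- the node towards which the edge points -/
  head : Fin m → Fin n
  adj : ∀ k, G.toSimpleGraph.Adj (tail k) (head k)
  existsUnique : ∀ i j, G.toSimpleGraph.Adj i j →
    ∃! k, (tail k = i ∧ head k = j) ∨ (tail k = j ∧ head k = i)

namespace EdgeOrdering

variable {n m : ℕ} {G : WeightedGraph n}

/-- The incidence matrix: `1` where the edge originates, `-1` where it ends, `0` otherwise. -/
def incidence (e : EdgeOrdering G m) : Matrix (Fin n) (Fin m) ℝ :=
  fun i k => if i = e.tail k then 1 else if i = e.head k then -1 else 0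

/-- The weight `a_k` of the `k`-th edge. -/
def edgeWeight (e : EdgeOrdering G m) (k : Fin m) : ℝ := G.weight (e.tail k) (e.head k)

/-- The nonlinearity `g_k` of the `k`-th edge. -/
def edgeFun (e : EdgeOrdering G m) (g : Fin n → Fin n → ℝ → ℝ) (k : Fin m) : ℝ → ℝ :=
  g (e.tail k) (e.head k)

/-- The vectorized right-hand side `x ↦ -B g(Bᵀ x)`, where
`g(y) = (a_1 g_1(y_1), …, a_m g_m(y_m))`. -/
def vectorField (e : EdgeOrdering G m) (g : Fin n → Fin n → ℝ → ℝ)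
    (x : EuclideanSpace ℝ (Fin n)) : EuclideanSpace ℝ (Fin n) :=
  WithLp.toLp 2 (-(e.incidence *ᵥ
    fun k => e.edgeWeight k * e.edgeFun g k ((e.incidenceᵀ *ᵥ x.ofLp) k)))

/-- The set `H₁` of all `x` with `0 ∈ ∏ₖ F[g_k](B_{·,k}ᵀ x)`. -/
def limitSet (e : EdgeOrdering G m) (g : Fin n → Fin n → ℝ → ℝ) :
    Set (EuclideanSpace ℝ (Fin n)) :=
  {x | (0 : Fin m → ℝ) ∈
    Set.univ.pi fun k => filippovMap (e.edgeFun g k) ((e.incidenceᵀ *ᵥ x.ofLp) k)}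

end EdgeOrdering

/-- The right-hand side of the protocol with nonlinear communication,
`ẋ_i = -∑_j a_{ij} g_{ij}(x_i - x_j)`. -/
def nodeField {n : ℕ} (G : WeightedGraph n) (g : Fin n → Fin n → ℝ → ℝ)
    (x : EuclideanSpace ℝ (Fin n)) : EuclideanSpace ℝ (Fin n) :=
  WithLp.toLp 2 fun i => -∑ j, G.weight i j * g i j (x i - x j)

/-- `f` is increasing (not necessarily strictly, nor continuous) and `|f(y)| → ∞` as `y → ∞`. -/
def IsIncreasingUnbounded (f : ℝ → ℝ) : Prop :=
  Monotone f ∧ Tendsto (fun y => |f y|) atTop atTop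

end Consensus

end

/-! Each odd increasing `g_k` has a threshold `r_k` such that `0 ∈ F[g_k](w)` whenever `|w| ≤ r_k`,
so the polyhedron `P = {z : |B_{·,k}ᵀ z| ≤ r_k for all k}` lies in the limit set. For every `z ∈ P`,
`‖x - z‖²` is a Lyapunov function: pairing the field with `x - z` gives `-∑ a_k (y_k - w_k) g_k(y_k)
≤ 0`, where `y = Bᵀx` and `w = Bᵀz` (`inner_sub_vectorField`, `sub_mul_nonneg_of_abs_le`), and the
bound survives closed convex hulls (`inner_le_of_mem_filippovMap`). For `z = 0` the decay rate is
bounded away from zero outside any thickening of `P`, so the trajectory keeps meeting every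
thickening. A limit point of such visits lies in `P`, and monotonicity of the distance to that very
point gives convergence of the whole trajectory to it, with no invariance principle. -/

open scoped RealInnerProductSpace

namespace Consensus

section Filippov

/-- A one-sided bound on `⟪y - z, X y⟫` near `x` passes to the Filippov map of a locally bounded
field `X`. -/
theorem inner_le_of_mem_filippovMap {E : Type*} [NormedAddCommGroup E] [InnerProductSpace ℝ E]
    [MeasureSpace E] {X : E → E} {x z v : E} {c M δ₀ : ℝ} (hδ₀ : 0 < δ₀)
    (hc : ∀ y ∈ Metric.ball x δ₀, ⟪y - z, X y⟫ ≤ c)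
    (hM : ∀ y ∈ Metric.ball x δ₀, ‖X y‖ ≤ M) (hv : v ∈ filippovMap X x) :
    ⟪x - z, v⟫ ≤ c := by
  have hM0 : 0 ≤ M := (norm_nonneg _).trans (hM x (Metric.mem_ball_self hδ₀))
  -- The half-space needs a fixed normal `x - z`, whereas `hc` pairs with the moving `y - z`; on a
  -- ball of radius `δ` the exchange costs at most `δ * M`.
  have key : ∀ δ, 0 < δ → δ ≤ δ₀ → ⟪x - z, v⟫ ≤ c + δ * M := by
    intro δ hδ hle
    have hv' := by simpa only [filippovMap, mem_iInter] using hv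
    have hmem := hv' δ hδ ∅ measure_empty
    have hconv : Convex ℝ {w : E | ⟪x - z, w⟫ ≤ c + δ * M} :=
      convex_halfSpace_le (innerₛₗ ℝ (x - z)).isLinear _
    have hclosed : IsClosed {w : E | ⟪x - z, w⟫ ≤ c + δ * M} :=
      isClosed_le (by fun_prop) continuous_const
    refine closure_minimal (convexHull_min ?_ hconv) hclosed hmem
    rintro _ ⟨y, ⟨hy, -⟩, rfl⟩
    have hy₀ := Metric.ball_subset_ball hle hy
    have hsplit : ⟪x - z, X y⟫ = ⟪y - z, X y⟫ + ⟪x - y, X y⟫ := by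
      rw [← inner_add_left]; congr 1; abel
    have hdist : ‖x - y‖ ≤ δ := by
      rw [← dist_eq_norm, dist_comm]; exact (Metric.mem_ball.1 hy).le
    have := (real_inner_le_norm (x - y) (X y)).trans
      (mul_le_mul hdist (hM y hy₀) (norm_nonneg _) hδ.le)
    simp only [mem_ofPred_eq, hsplit]
    linarith [hc y hy₀]
  have hlim : Tendsto (fun δ : ℝ => c + δ * M) (𝓝[>] 0) (𝓝 c) := by
    have : Tendsto (fun δ : ℝ => c + δ * M) (𝓝 0) (𝓝 (c + 0 * M)) :=
      (by fun_prop : Continuous fun δ : ℝ => c + δ * M).tendsto 0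
    simpa using this.mono_left nhdsWithin_le_nhds
  refine ge_of_tendsto hlim ?_
  filter_upwards [Ioo_mem_nhdsGT hδ₀] with δ hδ using key δ hδ.1 hδ.2.le

/-- If `f` is nonnegative to the right of `w` and nonpositive to its left, then
`0 ∈ F[f](w)`. -/
theorem zero_mem_filippovMap_real {f : ℝ → ℝ} {w : ℝ} (hpos : ∀ s, w < s → 0 ≤ f s)
    (hneg : ∀ s, s < w → f s ≤ 0) : 0 ∈ filippovMap f w := by
  simp only [filippovMap, mem_iInter]
  intro δ hδ S hS
  apply subset_closure
  -- A null set contains no interval, so sample points survive on both sides of `w`; the value `f w`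
  -- plays no role.
  have hex : ∀ a b : ℝ, a < b → ∃ p ∈ Ioo a b, p ∉ S := by
    intro a b hab
    by_contra! h
    have hle : volume (Ioo a b) ≤ volume S := measure_mono h
    rw [hS, Real.volume_Ioo] at hle
    simp only [nonpos_iff_eq_zero, ENNReal.ofReal_eq_zero] at hle
    linarith
  obtain ⟨p, hp, hpS⟩ := hex w (w + δ) (by linarith)
  obtain ⟨q, hq, hqS⟩ := hex (w - δ) w (by linarith)
  have hball : ∀ s, w - δ < s → s < w + δ → s ∈ Metric.ball w δ := fun s h₁ h₂ => by
    rw [Real.ball_eq_Ioo]; exact ⟨h₁, h₂⟩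
  have hfp : f p ∈ f '' (Metric.ball w δ \ S) :=
    mem_image_of_mem f ⟨hball p (by linarith [hp.1]) hp.2, hpS⟩
  have hfq : f q ∈ f '' (Metric.ball w δ \ S) :=
    mem_image_of_mem f ⟨hball q hq.1 (by linarith [hq.2]), hqS⟩
  refine segment_subset_convexHull hfq hfp ?_
  rw [segment_eq_Icc ((hneg q hq.2).trans (hpos p hp.1))]
  exact ⟨hneg q hq.2, hpos p hp.1⟩

end Filippov

section OddMonotone

variable {f : ℝ → ℝ}

/-- An odd, increasing, unbounded function has a threshold `r ≥ 0` beyond which it is positive and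
below which it is nonpositive. -/
theorem IsIncreasingUnbounded.exists_threshold (hf : IsIncreasingUnbounded f)
    (hodd : Function.Odd f) :
    ∃ r, 0 ≤ r ∧ (∀ s, r < s → 0 < f s) ∧ ∀ s, s < r → f s ≤ 0 := by
  have h0 : f 0 = 0 := by have := hodd 0; simp only [neg_zero] at this; linarith
  have hpos : ∀ s, 0 < f s → 0 < s := fun s hs => by
    by_contra! h
    linarith [hf.1 h]
  have hne : {s | 0 < f s}.Nonempty := by
    obtain ⟨s, hs, hs0⟩ := ((hf.2.eventually_gt_atTop 0).and (eventually_ge_atTop 0)).exists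
    refine ⟨s, ?_⟩
    rwa [abs_of_nonneg (h0 ▸ hf.1 hs0)] at hs
  have hbdd : BddBelow {s | 0 < f s} := ⟨0, fun s hs => (hpos s hs).le⟩
  refine ⟨sInf {s | 0 < f s}, le_csInf hne fun s hs => (hpos s hs).le, fun s hs => ?_,
    fun s hs => ?_⟩
  · obtain ⟨u, hu, hus⟩ := (csInf_lt_iff hbdd hne).1 hs
    exact lt_of_lt_of_le hu (hf.1 hus.le)
  · by_contra! h
    exact absurd (csInf_le hbdd h) (not_le.2 hs)

variable {r : ℝ}

theorem nonneg_of_neg_threshold_lt (hodd : Function.Odd f) (hr : ∀ s, s < r → f s ≤ 0) {s : ℝ}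
    (hs : -r < s) : 0 ≤ f s := by
  have := hr (-s) (by linarith)
  rw [hodd s] at this
  linarith

theorem zero_mem_filippovMap_of_abs_le (hodd : Function.Odd f) (hr : ∀ s, s < r → f s ≤ 0)
    {w : ℝ} (hw : |w| ≤ r) : 0 ∈ filippovMap f w :=
  zero_mem_filippovMap_real
    (fun _ hs => nonneg_of_neg_threshold_lt hodd hr ((abs_le.1 hw).1.trans_lt hs))
    (fun s hs => hr s (hs.trans_le (abs_le.1 hw).2))

/-- By oddness `f ≤ 0` left of `r` and `f ≥ 0` right of `-r`, so every `w ∈ [-r, r]` serves as a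
point where `f` changes sign. -/
theorem sub_mul_nonneg_of_abs_le (hodd : Function.Odd f) (hr : ∀ s, s < r → f s ≤ 0)
    {w y : ℝ} (hw : |w| ≤ r) : 0 ≤ (y - w) * f y := by
  obtain ⟨h₁, h₂⟩ := abs_le.1 hw
  rcases lt_trichotomy y w with h | h | h
  · exact mul_nonneg_of_nonpos_of_nonpos (by linarith) (hr y (h.trans_le h₂))
  · simp [h]
  · exact mul_nonneg (by linarith) (nonneg_of_neg_threshold_lt hodd hr (h₁.trans_lt h))

theorem mul_le_mul_self_of_lt_abs (hmono : Monotone f) (hodd : Function.Odd f) {ρ y : ℝ}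
    (hfρ : 0 ≤ f ρ) (hy : ρ < |y|) : ρ * f ρ ≤ y * f y := by
  have h : y * f y = |y| * f |y| := by
    rcases abs_choice y with h | h <;> rw [h]
    rw [hodd y]; ring
  rw [h]
  exact mul_le_mul hy.le (hmono hy.le) hfρ (abs_nonneg y)

theorem abs_le_of_abs_le (hmono : Monotone f) (hodd : Function.Odd f) {R y : ℝ} (hy : |y| ≤ R) :
    |f y| ≤ f R := by
  obtain ⟨h₁, h₂⟩ := abs_le.1 hy
  have := hmono h₁
  rw [hodd R] at this
  exact abs_le.2 ⟨this, hmono h₂⟩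

end OddMonotone

/-! ### Lyapunov estimate along trajectories -/

section Trajectory

theorem absolutelyContinuousOnInterval_norm {E : Type*} [SeminormedAddCommGroup E] {f : ℝ → E}
    {a b : ℝ} (hf : AbsolutelyContinuousOnInterval f a b) :
    AbsolutelyContinuousOnInterval (fun t => ‖f t‖) a b := by
  refine squeeze_zero (fun _ => Finset.sum_nonneg fun _ _ => dist_nonneg) (fun _ => ?_) hf
  exact Finset.sum_le_sum fun _ _ => by
    simpa only [dist_eq_norm] using dist_norm_norm_le _ _

/-- The squared distance from a Filippov trajectory to a point grows at most linearly in time,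
with twice the rate that bounds `⟪x - z, v⟫` for `v ∈ F[X](x)`. -/
theorem IsFilippovTrajectory.norm_sq_sub_le {n : ℕ}
    {X : EuclideanSpace ℝ (Fin n) → EuclideanSpace ℝ (Fin n)} {x : ℝ → EuclideanSpace ℝ (Fin n)}
    (hx : IsFilippovTrajectory X x) (z : EuclideanSpace ℝ (Fin n)) {c s t : ℝ} (hs : 0 ≤ s)
    (hst : s ≤ t) (hc : ∀ τ ∈ Ioo s t, ∀ v ∈ filippovMap X (x τ), ⟪x τ - z, v⟫ ≤ c) :
    ‖x t - z‖ ^ 2 - ‖x s - z‖ ^ 2 ≤ 2 * c * (t - s) := by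
  rcases hst.eq_or_lt with rfl | hlt
  · simp
  obtain ⟨hac, hsol⟩ := hx t (hs.trans_lt hlt)
  have hac' : AbsolutelyContinuousOnInterval x s t :=
    hac.mono (by rw [uIcc_of_le hst, uIcc_of_le (hs.trans hst)]; exact Icc_subset_Icc_left hs)
  have hconst : AbsolutelyContinuousOnInterval (fun _ : ℝ => z) s t :=
    (LipschitzWith.const z).lipschitzOnWith.absolutelyContinuousOnInterval
  have hnorm := absolutelyContinuousOnInterval_norm (hac'.fun_sub hconst)
  have hV : AbsolutelyContinuousOnInterval (fun τ => ‖x τ - z‖ ^ 2) s t := by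
    simpa only [pow_two] using hnorm.fun_mul hnorm
  rw [← hV.integral_deriv_eq_sub]
  have hle : (fun τ => deriv (fun τ => ‖x τ - z‖ ^ 2) τ) ≤ᵐ[volume.restrict (Icc s t)]
      fun _ => 2 * c := by
    rw [Measure.restrict_congr_set Ioo_ae_eq_Icc.symm, EventuallyLE,
      ae_restrict_iff' measurableSet_Ioo]
    filter_upwards [hsol] with τ hτ hmem
    obtain ⟨hd, hF⟩ := hτ ⟨hs.trans_lt hmem.1, hmem.2⟩
    have := (hd.hasDerivAt.sub_const z).norm_sq
    rw [this.deriv]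
    linarith [hc τ hmem _ hF]
  calc ∫ τ in s..t, deriv (fun τ => ‖x τ - z‖ ^ 2) τ
      ≤ ∫ _ in s..t, 2 * c := intervalIntegral.integral_mono_ae_restrict hst
        hV.intervalIntegrable_deriv intervalIntegrable_const hle
    _ = 2 * c * (t - s) := by
        rw [intervalIntegral.integral_const, smul_eq_mul, mul_comm]

end Trajectory

/-! ### Edge form of the field and convergence -/

namespace EdgeOrdering

variable {n m : ℕ} {G : WeightedGraph n} (e : EdgeOrdering G m) {g : Fin n → Fin n → ℝ → ℝ}

theorem tail_ne_head (k : Fin m) : e.tail k ≠ e.head k := (e.adj k).ne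

theorem edgeWeight_pos (k : Fin m) : 0 < e.edgeWeight k := e.adj k

theorem incidence_transpose_mulVec (x : Fin n → ℝ) (k : Fin m) :
    (e.incidenceᵀ *ᵥ x) k = x (e.tail k) - x (e.head k) := by
  have h : ∀ i, e.incidenceᵀ k i * x i =
      (if i = e.tail k then x i else 0) - (if i = e.head k then x i else 0) := by
    intro i
    simp only [Matrix.transpose_apply, incidence]
    have := e.tail_ne_head k
    split_ifs <;> simp_all
  simp only [Matrix.mulVec, dotProduct, h, Finset.sum_sub_distrib, Finset.sum_ite_eq',
    Finset.mem_univ, if_true]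

theorem nodeField_eq_vectorField
    (hsymm : ∀ i j, G.toSimpleGraph.Adj i j → g i j = g j i)
    (hodd : ∀ i j, G.toSimpleGraph.Adj i j → Function.Odd (g i j)) :
    nodeField G g = e.vectorField g := by
  funext x
  ext i
  simp only [nodeField, vectorField, Pi.neg_apply, neg_inj, Matrix.mulVec, dotProduct]
  set f : Fin n → Fin n → ℝ := fun i j => G.weight i j * g i j (x i - x j) with hf
  have hanti : ∀ k, f (e.head k) (e.tail k) = -f (e.tail k) (e.head k) := by
    intro k
    simp only [hf]
    rw [G.symm, ← hsymm _ _ (e.adj k), ← neg_sub, hodd _ _ (e.adj k)]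
    ring
  -- Writing each edge term as a sum over neighbours lets the two sums be exchanged; each neighbour
  -- `j` of `i` is then hit by exactly one `k`.
  have hterm : ∀ k, e.incidence i k * (e.edgeWeight k *
      e.edgeFun g k (∑ j, e.incidenceᵀ k j * x j)) =
      ∑ j, if (e.tail k = i ∧ e.head k = j) ∨ (e.tail k = j ∧ e.head k = i)
        then f i j else 0 := by
    intro k
    have hy : ∑ j, e.incidenceᵀ k j * x j = x (e.tail k) - x (e.head k) :=
      e.incidence_transpose_mulVec x.ofLp k
    have hfk : e.edgeWeight k * e.edgeFun g k (∑ j, e.incidenceᵀ k j * x j) =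
        f (e.tail k) (e.head k) := by rw [hy]; rfl
    rw [hfk]
    have hne := e.tail_ne_head k
    by_cases h₁ : i = e.tail k
    · subst h₁
      simp [incidence, hne.symm]
    by_cases h₂ : i = e.head k
    · subst h₂
      simp [incidence, hne, hne.symm, hanti]
    · simp [incidence, h₁, h₂, Ne.symm h₁, Ne.symm h₂]
  simp only [hterm]
  rw [Finset.sum_comm]
  refine Finset.sum_congr rfl fun j _ => ?_
  by_cases hij : G.toSimpleGraph.Adj i j
  · obtain ⟨k, hk, huniq⟩ := e.existsUnique i j hij
    rw [Finset.sum_eq_single k, if_pos hk]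
    · intro l _ hl
      exact if_neg fun h => hl (huniq l h)
    · simp
  · have h0 : G.weight i j = 0 := le_antisymm (not_lt.1 hij) (G.nonneg i j)
    simp [hf, h0]

theorem inner_sub_vectorField (x z : EuclideanSpace ℝ (Fin n)) :
    ⟪x - z, e.vectorField g x⟫ = -∑ k, e.edgeWeight k *
      (((e.incidenceᵀ *ᵥ x.ofLp) k - (e.incidenceᵀ *ᵥ z.ofLp) k) *
        e.edgeFun g k ((e.incidenceᵀ *ᵥ x.ofLp) k)) := by
  rw [EuclideanSpace.inner_eq_star_dotProduct]
  simp only [vectorField, star_trivial, WithLp.ofLp_sub, neg_dotProduct, neg_inj]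
  rw [dotProduct_comm, Matrix.dotProduct_mulVec, ← Matrix.mulVec_transpose, Matrix.mulVec_sub,
    dotProduct]
  refine Finset.sum_congr rfl fun k _ => ?_
  rw [Pi.sub_apply]
  ring

theorem exists_norm_vectorField_le (hmono : ∀ k, Monotone (e.edgeFun g k))
    (hodd : ∀ k, Function.Odd (e.edgeFun g k)) (x : EuclideanSpace ℝ (Fin n)) :
    ∃ M, ∀ y ∈ Metric.ball x 1, ‖e.vectorField g y‖ ≤ M := by
  -- Bounds the difference of two coordinates of any point in the unit ball around `x`.
  set R := 2 * (‖x‖ + 1)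
  let K : Set (Fin m → ℝ) := Set.univ.pi fun k =>
    Icc (-(e.edgeWeight k * e.edgeFun g k R)) (e.edgeWeight k * e.edgeFun g k R)
  have hK : IsCompact K := isCompact_univ_pi fun k => isCompact_Icc
  have hcont : Continuous fun c : Fin m → ℝ =>
      (WithLp.toLp 2 (-(e.incidence *ᵥ c)) : EuclideanSpace ℝ (Fin n)) :=
    (PiLp.continuous_toLp 2 _).comp (Continuous.matrix_mulVec continuous_const continuous_id).neg
  obtain ⟨M, hM⟩ := hK.exists_bound_of_continuousOn hcont.continuousOn
  refine ⟨M, fun y hy => hM _ fun k _ => ?_⟩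
  have hyR : |(e.incidenceᵀ *ᵥ y.ofLp) k| ≤ R := by
    rw [e.incidence_transpose_mulVec]
    have hny : ‖y‖ ≤ ‖x‖ + 1 := by
      have := norm_le_norm_add_norm_sub x y
      rw [Metric.mem_ball, dist_eq_norm, norm_sub_rev] at hy
      linarith
    have h₁ := PiLp.norm_apply_le y (e.tail k)
    have h₂ := PiLp.norm_apply_le y (e.head k)
    have h₃ := norm_sub_le (y (e.tail k)) (y (e.head k))
    rw [Real.norm_eq_abs (_ - _)] at h₃
    linarith
  have hw := e.edgeWeight_pos k
  refine abs_le.1 ?_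
  rw [abs_mul, abs_of_pos hw]
  exact mul_le_mul_of_nonneg_left (abs_le_of_abs_le (hmono k) (hodd k) hyR) hw.le

variable {e} in
/-- Every Filippov trajectory converges to a point `z` that satisfies `|B_{·,k}ᵀ z| ≤ r k` for all
`k`, where `r k` is the threshold of the `k`-th nonlinearity. -/
theorem exists_tendsto_of_isFilippovTrajectory {r : Fin m → ℝ}
    (hmono : ∀ k, Monotone (e.edgeFun g k)) (hodd : ∀ k, Function.Odd (e.edgeFun g k))
    (hr0 : ∀ k, 0 ≤ r k) (hrpos : ∀ k s, r k < s → 0 < e.edgeFun g k s)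
    (hrneg : ∀ k s, s < r k → e.edgeFun g k s ≤ 0)
    {x : ℝ → EuclideanSpace ℝ (Fin n)} (hx : IsFilippovTrajectory (e.vectorField g) x) :
    ∃ z, (∀ k, |(e.incidenceᵀ *ᵥ z.ofLp) k| ≤ r k) ∧ Tendsto x atTop (𝓝 z) := by
  have hdecr : ∀ z : EuclideanSpace ℝ (Fin n), (∀ k, |(e.incidenceᵀ *ᵥ z.ofLp) k| ≤ r k) →
      ∀ s t, 0 ≤ s → s ≤ t → ‖x t - z‖ ≤ ‖x s - z‖ := by
    intro z hz s t hs hst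
    have := hx.norm_sq_sub_le z (c := 0) hs hst fun τ _ v hv => by
      obtain ⟨M, hM⟩ := e.exists_norm_vectorField_le hmono hodd (x τ)
      refine inner_le_of_mem_filippovMap one_pos (fun y _ => ?_) hM hv
      rw [e.inner_sub_vectorField, neg_nonpos]
      exact Finset.sum_nonneg fun k _ => mul_nonneg (e.edgeWeight_pos k).le
        (sub_mul_nonneg_of_abs_le (hodd k) (hrneg k) (hz k))
    exact (sq_le_sq₀ (norm_nonneg _) (norm_nonneg _)).1 (by linarith)
  have hcont : ∀ k, Continuous fun y : EuclideanSpace ℝ (Fin n) =>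
      (e.incidenceᵀ *ᵥ y.ofLp) k := fun k => by
    simp only [e.incidence_transpose_mulVec]
    fun_prop
  have hzero : ∀ k, (e.incidenceᵀ *ᵥ (0 : EuclideanSpace ℝ (Fin n)).ofLp) k = 0 := by
    simp
  have hfreq : ∀ ε : ℝ, 0 < ε → ∀ T : ℝ, ∃ t, T ≤ t ∧ 0 ≤ t ∧
      ∀ k, |(e.incidenceᵀ *ᵥ (x t).ofLp) k| ≤ r k + ε := by
    intro ε hε T
    by_contra! hbad
    have hρ : ∀ k, 0 < e.edgeWeight k * ((r k + ε) * e.edgeFun g k (r k + ε)) := fun k =>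
      mul_pos (e.edgeWeight_pos k) (mul_pos (by linarith [hr0 k]) (hrpos k _ (by linarith)))
    obtain ⟨k₀, -⟩ := hbad (max T 0) (le_max_left _ _) (le_max_right _ _)
    have : Nonempty (Fin m) := ⟨k₀⟩
    obtain ⟨k₁, hk₁⟩ := Finite.exists_min fun k =>
      e.edgeWeight k * ((r k + ε) * e.edgeFun g k (r k + ε))
    set c := e.edgeWeight k₁ * ((r k₁ + ε) * e.edgeFun g k₁ (r k₁ + ε))
    have hcpos : 0 < c := hρ k₁
    set s := max T 0
    have hs0 : 0 ≤ s := le_max_right _ _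
    have hbound : ∀ t, s ≤ t → ‖x t - 0‖ ^ 2 - ‖x s - 0‖ ^ 2 ≤ 2 * (-c) * (t - s) := by
      intro t hst
      refine hx.norm_sq_sub_le 0 hs0 hst fun τ hτ v hv => ?_
      obtain ⟨k, hk⟩ := hbad τ ((le_max_left _ _).trans hτ.1.le) (hs0.trans hτ.1.le)
      obtain ⟨M, hM⟩ := e.exists_norm_vectorField_le hmono hodd (x τ)
      have hopen : IsOpen {y : EuclideanSpace ℝ (Fin n) |
          r k + ε < |(e.incidenceᵀ *ᵥ y.ofLp) k|} :=
        isOpen_lt continuous_const (hcont k).abs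
      obtain ⟨δ, hδ, hball⟩ := Metric.isOpen_iff.1 hopen (x τ) hk
      -- Radius `δ` keeps the same edge `k` violated nearby; radius `1` gives boundedness of the
      -- field.
      refine inner_le_of_mem_filippovMap (lt_min hδ one_pos) (fun y hy => ?_)
        (fun y hy => hM y (Metric.ball_subset_ball (min_le_right _ _) hy)) hv
      have hyk : r k + ε < |(e.incidenceᵀ *ᵥ y.ofLp) k| :=
        hball (Metric.ball_subset_ball (min_le_left _ _) hy)
      rw [e.inner_sub_vectorField, neg_le_neg_iff]
      simp only [hzero]
      -- All edge terms are nonnegative, so the violated edge alone supplies the rate `c`.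
      refine (hk₁ k).trans (le_trans ?_ (Finset.single_le_sum (fun l _ =>
        mul_nonneg (e.edgeWeight_pos l).le (sub_mul_nonneg_of_abs_le (hodd l) (hrneg l)
          (by simpa using hr0 l))) (Finset.mem_univ k)))
      rw [sub_zero]
      exact mul_le_mul_of_nonneg_left (mul_le_mul_self_of_lt_abs (hmono k) (hodd k)
        (hrpos k _ (by linarith)).le hyk) (e.edgeWeight_pos k).le
    -- By this time the decay at rate `2c` would exceed `‖x s‖²`, making a square negative.
    have hlast := hbound (s + (‖x s - 0‖ ^ 2 + 1) / (2 * c))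
      (le_add_of_nonneg_right (by positivity))
    have hval : 2 * (-c) * (s + (‖x s - 0‖ ^ 2 + 1) / (2 * c) - s) = -(‖x s - 0‖ ^ 2 + 1) := by
      field_simp
      ring
    rw [hval] at hlast
    linarith [sq_nonneg ‖x (s + (‖x s - 0‖ ^ 2 + 1) / (2 * c)) - 0‖]
  choose t htN ht0 htk using fun N : ℕ => hfreq (1 / ((N : ℝ) + 1)) (by positivity) N
  have hmem : ∀ N, x (t N) ∈ Metric.closedBall (0 : EuclideanSpace ℝ (Fin n)) ‖x 0‖ := fun N => by
    simpa using hdecr 0 (fun k => by simpa using hr0 k) 0 (t N) le_rfl (ht0 N)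
  obtain ⟨z, -, φ, hφ, hlim⟩ := (isCompact_closedBall _ _).tendsto_subseq hmem
  have hz : ∀ k, |(e.incidenceᵀ *ᵥ z.ofLp) k| ≤ r k := fun k => by
    have h₁ := ((hcont k).abs.tendsto z).comp hlim
    have h₂ : Tendsto (fun N => r k + 1 / ((φ N : ℝ) + 1)) atTop (𝓝 (r k + 0)) :=
      (tendsto_one_div_add_atTop_nhds_zero_nat.comp hφ.tendsto_atTop).const_add _
    rw [add_zero] at h₂
    exact le_of_tendsto_of_tendsto' h₁ h₂ fun N => htk (φ N) k
  -- Since `z` itself satisfies the threshold bounds, `hdecr` applies to it: one visit close to `z`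
  -- confines all later times.
  refine ⟨z, hz, Metric.tendsto_atTop.2 fun ε hε => ?_⟩
  obtain ⟨N, hN⟩ := (Metric.tendsto_atTop.1 hlim) ε hε
  refine ⟨t (φ N), fun τ hτ => ?_⟩
  rw [dist_eq_norm]
  refine (hdecr z hz _ τ (ht0 _) hτ).trans_lt ?_
  rw [← dist_eq_norm]
  exact hN N le_rfl

end EdgeOrdering

end Consensus

theorem mainTheorem3 {n m : ℕ} (G : Consensus.WeightedGraph n)
    (hconn : G.toSimpleGraph.Connected)
    (e : Consensus.EdgeOrdering G m)
    (g : Fin n → Fin n → ℝ → ℝ)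
    (hsymm : ∀ i j, G.toSimpleGraph.Adj i j → g i j = g j i)
    (hmono : ∀ i j, G.toSimpleGraph.Adj i j → Consensus.IsIncreasingUnbounded (g i j))
    (hodd : ∀ i j, G.toSimpleGraph.Adj i j → Function.Odd (g i j)) :
    Consensus.nodeField G g = e.vectorField g ∧
      ∀ x : ℝ → EuclideanSpace ℝ (Fin n),
        Consensus.IsFilippovTrajectory (Consensus.nodeField G g) x →
          Tendsto (fun t => Metric.infEDist (x t) (e.limitSet g)) atTop (𝓝 0) := by
  have heq := e.nodeField_eq_vectorField hsymm hodd
  refine ⟨heq, fun x hx => ?_⟩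
  rw [heq] at hx
  have hedge : ∀ k, Consensus.IsIncreasingUnbounded (e.edgeFun g k) :=
    fun k => hmono _ _ (e.adj k)
  have hoddk : ∀ k, Function.Odd (e.edgeFun g k) := fun k => hodd _ _ (e.adj k)
  choose r hr0 hrpos hrneg using fun k => (hedge k).exists_threshold (hoddk k)
  obtain ⟨z, hz, hlim⟩ := Consensus.EdgeOrdering.exists_tendsto_of_isFilippovTrajectory
    (fun k => (hedge k).1) hoddk hr0 hrpos hrneg hx
  have hzmem : z ∈ e.limitSet g := fun k _ =>
    Consensus.zero_mem_filippovMap_of_abs_le (hoddk k) (hrneg k) (hz k)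
  exact tendsto_of_tendsto_of_tendsto_of_le_of_le tendsto_const_nhds
    (tendsto_iff_edist_tendsto_0.1 hlim) (fun _ => zero_le)
    (fun _ => Metric.infEDist_le_edist_of_mem hzmem)
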